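/- Let a parameterized problem be a pair $(X,\kappa)$ with $X\subseteq\{0,1\}^*$ and $\kappa:\{0,1\}^*\to\mathbb{N}$ computable in polynomial time. A polynomial Turing kernelization for $(X,\kappa)$ is a deterministic oracle Turing machine that, with oracle $X$, decides in time polynomial in $|x|$ whether $x\in X$, and that on every input $x$ queries only strings of length at most $q(\kappa(x))$, for some polynomial $q$ that does not depend on $x$. It is a polynomial truth-table kernelization if moreover it is non-adaptive: for every input $x$, the set of strings that it queries is independent of the oracle's answers, i.e. the same for every oracle $A\subseteq\{0,1\}^*$. Theorem. There is a parameterized problem that has a polynomial Turing kernelization but no polynomial truth-table kernelization. -/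

import Mathlib

open Turing Computability

/-- A parameterized problem: a set `X` of binary strings together with a parameterization `κ`,
i.e. a polynomial-time computable function from binary strings to natural numbers
(with values written in binary). -/
structure ParameterizedProblem where
  X : Set (List Bool)
  κ : List Bool → ℕ
  polyTime : Nonempty (TM2ComputableInPolyTime (id : List Bool → List Bool) encodeNat κ)

/-- A deterministic oracle machine: a multi-stack Turing machine (Mathlib's `TM2` model) with a
distinguished query stack and distinguished labels `query`, `yes`, `no`.

The finite sets of stacks, labels and values of the internal variable are `Fin k`, `Fin l`,
`Fin s`. Stack cells hold bits; larger stack alphabets are available at no cost in time, since one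
step can push to and pop from several stacks: a symbol from an alphabet with `2 ^ b` elements is a
row of `b` parallel stacks. The statement that `prog` assigns to `query` is never executed. -/
structure OracleTM where
  k : ℕ
  l : ℕ
  s : ℕ
  inputStack : Fin k
  queryStack : Fin k
  start : Fin l
  query : Fin l
  yes : Fin l
  no : Fin l
  startVar : Fin s
  accepting : Fin s → Bool
  prog : Fin l → TM2.Stmt (fun _ : Fin k => Bool) (Fin l) (Fin s)

namespace OracleTM

/-- Configurations: a label (`none` when halted), a value of the variable, the stack contents. -/
abbrev Cfg (M : OracleTM) : Type :=
  TM2.Cfg (fun _ : Fin M.k => Bool) (Fin M.l) (Fin M.s)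

/-- The initial configuration: the input is on the input stack, first symbol on top, and all other
stacks are empty. -/
def initialCfg (M : OracleTM) (x : List Bool) : M.Cfg :=
  ⟨some M.start, M.startVar, Function.update (fun _ => []) M.inputStack x⟩

open Classical in
/-- One step with oracle `A`. At the label `query`, control passes to `yes` or `no` according to
whether the string on the query stack belongs to `A`. At any other label the machine executes its
program. Halted configurations do not change. -/
noncomputable def step (M : OracleTM) (A : Set (List Bool)) (c : M.Cfg) : M.Cfg :=
  if c.l = some M.query then
    { c with l := some (if c.stk M.queryStack ∈ A then M.yes else M.no) }
  else (TM2.step M.prog c).getD c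

/-- The configuration reached on input `x` with oracle `A` after `t` steps. -/
noncomputable def run (M : OracleTM) (A : Set (List Bool)) (x : List Bool) (t : ℕ) : M.Cfg :=
  (M.step A)^[t] (M.initialCfg x)

/-- With oracle `A` and input `x`, the machine halts within `t` steps. -/
def HaltsIn (M : OracleTM) (A : Set (List Bool)) (x : List Bool) (t : ℕ) : Prop :=
  (M.run A x t).l = none

/-- With oracle `A` and input `x`, the machine halts and accepts. -/
def Accepts (M : OracleTM) (A : Set (List Bool)) (x : List Bool) : Prop :=
  ∃ t, (M.run A x t).l = none ∧ M.accepting (M.run A x t).var = true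

/-- The set of all strings that the machine queries on input `x` with oracle `A`. -/
def queries (M : OracleTM) (A : Set (List Bool)) (x : List Bool) : Set (List Bool) :=
  {w | ∃ t, (M.run A x t).l = some M.query ∧ (M.run A x t).stk M.queryStack = w}

/-- `M` is nonadaptive: on every input, its queries do not depend on the oracle's answers. -/
def Nonadaptive (M : OracleTM) : Prop :=
  ∀ (x : List Bool) (A B : Set (List Bool)), M.queries A x = M.queries B x

/-- `M` is a Turing kernelization of size `f` for the problem `P`: with oracle `P.X`, it decides
`P.X` in polynomial time, and on input `x` it queries only strings of length at most
`f (P.κ x)`. -/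
structure IsTuringKernelization (M : OracleTM) (P : ParameterizedProblem) (f : ℕ → ℕ) : Prop where
  polyTime : ∃ p : Polynomial ℕ, ∀ x : List Bool, M.HaltsIn P.X x (p.eval x.length)
  decides : ∀ x : List Bool, M.Accepts P.X x ↔ x ∈ P.X
  size : ∀ x : List Bool, ∀ w ∈ M.queries P.X x, w.length ≤ f (P.κ x)

end OracleTM

namespace ParameterizedProblem

/-- The problem has a polynomial Turing kernelization. -/
def HasPolyTuringKernelization (P : ParameterizedProblem) : Prop :=
  ∃ (M : OracleTM) (q : Polynomial ℕ), M.IsTuringKernelization P (fun n => q.eval n)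

/-- The problem has a polynomial truth-table kernelization, i.e. a nonadaptive polynomial Turing
kernelization. -/
def HasPolyTruthTableKernelization (P : ParameterizedProblem) : Prop :=
  ∃ (M : OracleTM) (q : Polynomial ℕ),
    M.IsTuringKernelization P (fun n => q.eval n) ∧ M.Nonadaptive

end ParameterizedProblem

/-! For each `j` a secret word `W j` describes a path in the `j`-th binary tree. Strings with tag
`false` ask whether a node lies on the path. A string with tag `true`, `j` zeros and `n` ones asks
for the last symbol of the path, but is answered honestly only if `n ≥ 2 ^ k`, where `k` is the
number of `true` on the path; otherwise it is rejected. Its parameter is `2 ^ j`, whatever `n` is.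

An adaptive machine finds the path from the root with at most two queries per level, all of length
polynomial in `j`, and tests the threshold by halving `n` at each `true`. So every `W` with `|W j| ≤
(j + 2) ^ 3` gives a polynomial Turing kernelization, computable or not.

A nonadaptive machine must fix its queries without knowing the path. Take paths with about `j ^ 2`
symbols `true`. The threshold is then about `2 ^ (j ^ 2)`, beyond every polynomial in `2 ^ j`, so
the admissible queries with tag `true` and index `j` are all rejected and reveal nothing. An input
just meeting the threshold has length `2 ^ O(j ^ 2)`, which allows `2 ^ O(j ^ 2)` queries. But since
runs of `false` of length below `j` may precede each `true`, there are `j ^ (j ^ 2)` candidate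
paths, which is more (`exists_large_index`). Some final node is not queried (`exists_word_notMem`),
and appending it or not changes the correct answer but none of the oracle's answers
(`mem_pathSet_update`).

Machines with bounds `n ^ c` and `k ^ d` are countable, and each is defeated by finitely many values
of `W` (`exists_forall_defeats`), so a finite-extension argument (`exists_sequence_forall_mem`)
defeats them all. -/

/-! ### The parameterization is computable in polynomial time -/

/-- The parameterization: strings starting with `true` have parameter `2 ^ j` where `j` counts the
remaining zeros; the parameter of any other string is at least its length. -/
def zeroExpParam : List Bool → ℕ
  | [] => 1
  | false :: w => 2 ^ w.length
  | true :: w => 2 ^ w.count false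

/-- Binary numerals have the least significant bit first. A machine can thus write a power of two by
pushing one `true` and then a `false` for each counted symbol. -/
theorem encodeNat_two_pow (j : ℕ) : encodeNat (2 ^ j) = List.replicate j false ++ [true] := by
  have h : ∀ j : ℕ, ∃ p : PosNum, (p : ℕ) = 2 ^ j ∧
      encodePosNum p = List.replicate j false ++ [true] := by
    intro j
    induction j with
    | zero => exact ⟨1, rfl, rfl⟩
    | succ j ih =>
      obtain ⟨p, hp, he⟩ := ih
      refine ⟨p.bit0, ?_, ?_⟩
      · rw [PosNum.cast_bit0, hp]; ring
      · simp [encodePosNum, he, List.replicate_succ]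
  obtain ⟨p, hp, he⟩ := h j
  rw [← hp, ← he, encodeNat, PosNum.of_to_nat]
  rfl

namespace ZeroExpParam

open TM2.Stmt

/-- The program of a machine computing `zeroExpParam`. Label `1` copies the remaining input as
zeros, label `2` copies only its zeros. -/
def prog : Fin 3 → TM2.Stmt (fun _ : Fin 2 => Bool) (Fin 3) (Option Bool) := ![
  push 1 (fun _ => true) <| pop 0 (fun _ a => a) <| goto fun v => if v = some true then 2 else 1,
  pop 0 (fun _ a => a) <| branch (fun v => v.isNone) halt <| push 1 (fun _ => false) <|
    goto fun _ => 1,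
  pop 0 (fun _ a => a) <| branch (fun v => v.isNone) halt <|
    branch (fun v => v = some false) (push 1 (fun _ => false) <| goto fun _ => 2) <|
    goto fun _ => 2]

/-- The machine with program `prog`. -/
def machine : FinTM2 where
  K := Fin 2
  k₀ := 0
  k₁ := 1
  Γ _ := Bool
  Λ := Fin 3
  main := 0
  σ := Option Bool
  initialState := none
  m := prog

/-- The configuration with the given label, variable, and stacks. -/
def cfg (l : Option (Fin 3)) (v : Option Bool) (a b : List Bool) :
    TM2.Cfg (fun _ : Fin 2 => Bool) (Fin 3) (Option Bool) :=
  ⟨l, v, ![a, b]⟩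

theorem update_zero (a b c : List Bool) :
    Function.update (β := fun _ : Fin 2 => List Bool) ![a, b] 0 c = ![c, b] := by
  funext k; fin_cases k <;> rfl

theorem update_one (a b c : List Bool) :
    Function.update (β := fun _ : Fin 2 => List Bool) ![a, b] 1 c = ![a, c] := by
  funext k; fin_cases k <;> rfl

theorem step_start (v : Option Bool) (b : List Bool) (x : List Bool) :
    TM2.step prog (cfg (some 0) v x b) =
      some (cfg (some (if x.head? = some true then 2 else 1)) x.head? x.tail (true :: b)) := by
  simp [cfg, prog, TM2.step, update_zero, update_one]

theorem step_one_cons (v : Option Bool) (a : Bool) (b : List Bool) (x : List Bool) :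
    TM2.step prog (cfg (some 1) v (a :: x) b) = some (cfg (some 1) (some a) x (false :: b)) := by
  simp [cfg, prog, TM2.step, update_zero, update_one]

theorem step_two_cons (v : Option Bool) (a : Bool) (b : List Bool) (x : List Bool) :
    TM2.step prog (cfg (some 2) v (a :: x) b) =
      some (cfg (some 2) (some a) x (if a then b else false :: b)) := by
  cases a <;> simp [cfg, prog, TM2.step, update_zero, update_one]

theorem step_one_nil (v : Option Bool) (b : List Bool) :
    TM2.step prog (cfg (some 1) v [] b) = some (cfg none none [] b) := by
  simp [cfg, prog, TM2.step, update_zero, update_one]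

theorem step_two_nil (v : Option Bool) (b : List Bool) :
    TM2.step prog (cfg (some 2) v [] b) = some (cfg none none [] b) := by
  simp [cfg, prog, TM2.step, update_zero, update_one]

theorem iterate_one (x : List Bool) : ∀ (v : Option Bool) (b : List Bool),
    (flip bind (TM2.step prog))^[x.length + 1] (some (cfg (some 1) v x b)) =
      some (cfg none none [] (List.replicate x.length false ++ b)) := by
  induction x with
  | nil => exact step_one_nil
  | cons a x ih =>
    intro v b
    rw [List.length_cons, Function.iterate_succ_apply]
    refine (congrArg _ (step_one_cons v a b x)).trans ?_
    rw [ih, List.replicate_succ', List.append_assoc]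
    rfl

theorem iterate_two (x : List Bool) : ∀ (v : Option Bool) (b : List Bool),
    (flip bind (TM2.step prog))^[x.length + 1] (some (cfg (some 2) v x b)) =
      some (cfg none none [] (List.replicate (x.count false) false ++ b)) := by
  induction x with
  | nil => exact step_two_nil
  | cons a x ih =>
    intro v b
    rw [List.length_cons, Function.iterate_succ_apply]
    refine (congrArg _ (step_two_cons v a b x)).trans ?_
    rw [ih]
    cases a
    · simp [List.replicate_succ']
    · simp

/-- Only the empty input needs the longer time: otherwise label `0` already consumes a symbol. -/
theorem iterate_start (x : List Bool) :
    (flip bind (TM2.step prog))^[x.length + 2] (some (cfg (some 0) none x [])) =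
        some (cfg none none [] (encodeNat (zeroExpParam x))) ∨
    (flip bind (TM2.step prog))^[x.length + 1] (some (cfg (some 0) none x [])) =
        some (cfg none none [] (encodeNat (zeroExpParam x))) := by
  rcases x with _ | ⟨_ | _, x⟩
  · left
    rw [show encodeNat (zeroExpParam []) = [true] from encodeNat_two_pow 0]
    rw [List.length_nil, Function.iterate_succ_apply]
    exact (congrArg _ (step_start none [] [])).trans (iterate_one [] _ _)
  · right
    rw [zeroExpParam, encodeNat_two_pow, List.length_cons, Function.iterate_succ_apply]
    exact (congrArg _ (step_start none [] (false :: x))).trans (iterate_one x _ _)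
  · right
    rw [zeroExpParam, encodeNat_two_pow, List.length_cons, Function.iterate_succ_apply]
    exact (congrArg _ (step_start none [] (true :: x))).trans (iterate_two x _ _)

end ZeroExpParam

open ZeroExpParam in
theorem zeroExpParam_polyTime :
    Nonempty (TM2ComputableInPolyTime (id : List Bool → List Bool) encodeNat zeroExpParam) := by
  have hinit (x : List Bool) : initList machine x = cfg (some 0) none x [] := by
    refine congrArg (TM2.Cfg.mk (some (0 : Fin 3)) none) (funext fun k : Fin 2 => ?_)
    fin_cases k <;> rfl
  have hhalt (x : List Bool) : haltList machine x = cfg none none [] x := by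
    refine congrArg (TM2.Cfg.mk none none) (funext fun k : Fin 2 => ?_)
    fin_cases k <;> rfl
  have h (x : List Bool) : Nonempty (TM2OutputsInTime machine x
      (some (encodeNat (zeroExpParam x))) (x.length + 2)) := by
    have key (t : ℕ) (ht : t ≤ x.length + 2)
        (h : (flip bind (TM2.step prog))^[t] (some (cfg (some 0) none x [])) =
          some (cfg none none [] (encodeNat (zeroExpParam x)))) :
        Nonempty (TM2OutputsInTime machine x
          (some (encodeNat (zeroExpParam x))) (x.length + 2)) := by
      rw [← hinit, ← hhalt] at h
      exact ⟨⟨⟨t, h⟩, ht⟩⟩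
    rcases iterate_start x with h | h
    · exact key _ le_rfl h
    · exact key _ (by omega) h
  refine ⟨⟨⟨machine, Equiv.refl Bool, Equiv.refl Bool⟩, Polynomial.X + 2, fun x => ?_⟩⟩
  have e : ∀ l : List Bool, List.map (Equiv.refl Bool).invFun l = l := List.map_id
  have e2 : (Polynomial.X + 2 : Polynomial ℕ).eval x.length = x.length + 2 := by simp
  exact e2 ▸ (e x).symm ▸ (e (encodeNat (zeroExpParam x))).symm ▸ (h x).some

/-! ### Countability of oracle machines -/

namespace Turing.TM2.Stmt

variable {K Λ σ : Type} {Γ : K → Type}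

/-- A numbering of the statements of a machine with finite components. -/
noncomputable def toNat [Encodable K] [Encodable Λ] [Encodable σ] [Finite Λ] [Finite σ]
    [∀ k, Countable (σ → Γ k)] [∀ k, Countable (σ → Option (Γ k) → σ)] : Stmt Γ Λ σ → ℕ
  | push k f q => Nat.pair 0 (Nat.pair (Encodable.encode k)
      (Nat.pair ((Encodable.ofCountable (σ → Γ k)).encode f) q.toNat))
  | peek k f q => Nat.pair 1 (Nat.pair (Encodable.encode k)
      (Nat.pair ((Encodable.ofCountable (σ → Option (Γ k) → σ)).encode f) q.toNat))
  | pop k f q => Nat.pair 2 (Nat.pair (Encodable.encode k)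
      (Nat.pair ((Encodable.ofCountable (σ → Option (Γ k) → σ)).encode f) q.toNat))
  | load f q => Nat.pair 3 (Nat.pair ((Encodable.ofCountable (σ → σ)).encode f) q.toNat)
  | branch f q r => Nat.pair 4 (Nat.pair ((Encodable.ofCountable (σ → Bool)).encode f)
      (Nat.pair q.toNat r.toNat))
  | goto f => Nat.pair 5 ((Encodable.ofCountable (σ → Λ)).encode f)
  | halt => Nat.pair 6 0

theorem toNat_injective [Encodable K] [Encodable Λ] [Encodable σ] [Finite Λ] [Finite σ]
    [∀ k, Countable (σ → Γ k)] [∀ k, Countable (σ → Option (Γ k) → σ)] :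
    Function.Injective (toNat : Stmt Γ Λ σ → ℕ) := by
  intro q
  induction q with
  | push k f q ih | peek k f q ih | pop k f q ih =>
    intro r h
    cases r <;> simp only [toNat, Nat.pair_eq_pair, Encodable.encode_inj,
      Nat.reduceEqDiff, true_and, false_and, OfNat.zero_ne_ofNat,
      OfNat.ofNat_ne_zero, zero_ne_one, one_ne_zero, OfNat.ofNat_ne_one, OfNat.one_ne_ofNat] at h
    obtain ⟨rfl, hf, hq⟩ := h
    rw [(Encodable.ofCountable _).encode_injective hf, ih hq]
  | load f q ih =>
    intro r h
    cases r <;> simp [toNat, Nat.pair_eq_pair] at h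
    rw [h.1, ih h.2]
  | branch f q r ihq ihr =>
    intro r h
    cases r <;> simp [toNat, Nat.pair_eq_pair] at h
    rw [h.1, ihq h.2.1, ihr h.2.2]
  | goto f =>
    intro r h
    cases r <;> simp [toNat, Nat.pair_eq_pair] at h
    rw [h]
  | halt =>
    intro r h
    cases r <;> simp [toNat, Nat.pair_eq_pair] at h
    rfl

end Turing.TM2.Stmt

namespace OracleTM

instance : Countable OracleTM := by
  have (k l s : ℕ) : Countable (TM2.Stmt (fun _ : Fin k => Bool) (Fin l) (Fin s)) :=
    TM2.Stmt.toNat_injective.countable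
  let f : OracleTM → Σ k l s : ℕ, Fin k × Fin k × Fin l × Fin l × Fin l × Fin l × Fin s ×
      (Fin s → Bool) × (Fin l → TM2.Stmt (fun _ : Fin k => Bool) (Fin l) (Fin s)) :=
    fun M => ⟨M.k, M.l, M.s, M.inputStack, M.queryStack, M.start, M.query, M.yes, M.no,
      M.startVar, M.accepting, M.prog⟩
  have hf : Function.Injective f := by
    rintro ⟨k, l, s, _, _, _, _, _, _, _, _, _⟩ ⟨k', l', s', _, _, _, _, _, _, _, _, _⟩ h
    simp only [f, Sigma.mk.injEq] at h
    obtain ⟨rfl, h⟩ := h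
    simp only [heq_eq_eq, Sigma.mk.injEq] at h
    obtain ⟨rfl, h⟩ := h
    simp only [heq_eq_eq, Sigma.mk.injEq] at h
    obtain ⟨rfl, h⟩ := h
    simp only [heq_eq_eq, Prod.mk.injEq] at h
    simp [h]
  exact hf.countable

/-! ### Runs and queries of oracle machines -/

variable (M : OracleTM) {A B : Set (List Bool)} {x : List Bool}

theorem run_succ (A : Set (List Bool)) (x : List Bool) (t : ℕ) :
    M.run A x (t + 1) = M.step A (M.run A x t) :=
  Function.iterate_succ_apply' ..

theorem step_of_halted (A : Set (List Bool)) {c : M.Cfg} (h : c.l = none) : M.step A c = c := by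
  obtain ⟨l, v, S⟩ := c
  subst h
  simp [step, TM2.step]

theorem iterate_step_of_halted (A : Set (List Bool)) {c : M.Cfg} (h : c.l = none) (t : ℕ) :
    (M.step A)^[t] c = c :=
  Function.iterate_fixed (M.step_of_halted A h) t

theorem HaltsIn.mono {t t' : ℕ} (h : M.HaltsIn A x t) (ht : t ≤ t') : M.HaltsIn A x t' := by
  obtain ⟨d, rfl⟩ := Nat.exists_eq_add_of_le' ht
  rw [HaltsIn, run, Function.iterate_add_apply, ← run, M.iterate_step_of_halted A h]
  exact h

/-- Oracles that agree on the queried strings lead to the same run. -/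
theorem run_congr (h : ∀ w ∈ M.queries A x, w ∈ A ↔ w ∈ B) (t : ℕ) :
    M.run A x t = M.run B x t := by
  induction t with
  | zero => rfl
  | succ t ih =>
    rw [run_succ, run_succ, ← ih, step, step]
    by_cases hq : (M.run A x t).l = some M.query
    · rw [if_pos hq, if_pos hq]
      have hw := h _ ⟨t, hq, rfl⟩
      by_cases hA : (M.run A x t).stk M.queryStack ∈ A
      · rw [if_pos hA, if_pos (hw.1 hA)]
      · rw [if_neg hA, if_neg (mt hw.2 hA)]
    · rw [if_neg hq, if_neg hq]

theorem accepts_congr (h : ∀ w ∈ M.queries A x, w ∈ A ↔ w ∈ B) :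
    M.Accepts A x ↔ M.Accepts B x := by
  simp only [Accepts, M.run_congr h]

/-- A machine that halts within `t` steps makes at most `t` queries. -/
theorem exists_finset_queries {t : ℕ} (h : M.HaltsIn A x t) :
    ∃ F : Finset (List Bool), F.card ≤ t ∧ M.queries A x ⊆ F := by
  classical
  refine ⟨(Finset.range t).image fun i => (M.run A x i).stk M.queryStack,
    Finset.card_image_le.trans (Finset.card_range t).le, ?_⟩
  rintro w ⟨i, hi, rfl⟩
  rcases lt_or_ge i t with hit | hit
  · exact Finset.mem_coe.2 (Finset.mem_image_of_mem _ (Finset.mem_range.2 hit))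
  · obtain ⟨d, rfl⟩ := Nat.exists_eq_add_of_le' hit
    rw [run, Function.iterate_add_apply, ← run, M.iterate_step_of_halted A h] at hi
    exact absurd (hi.symm.trans h) (by simp)

/-- With oracle `A`, the machine passes from `c` to `c'` in exactly `t` steps, and the queries it
makes meanwhile have length at most `b`. -/
def Reaches (A : Set (List Bool)) (b : ℕ) (c c' : M.Cfg) (t : ℕ) : Prop :=
  (M.step A)^[t] c = c' ∧ ∀ i < t, ((M.step A)^[i] c).l = some M.query →
    (((M.step A)^[i] c).stk M.queryStack).length ≤ b

variable {M} {b : ℕ} {c c' c'' : M.Cfg} {t t' : ℕ}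

theorem Reaches.trans (h : M.Reaches A b c c' t) (h' : M.Reaches A b c' c'' t') :
    M.Reaches A b c c'' (t + t') := by
  refine ⟨by rw [Nat.add_comm, Function.iterate_add_apply, h.1, h'.1], fun i hi hq => ?_⟩
  rcases lt_or_ge i t with hit | hit
  · exact h.2 i hit hq
  · obtain ⟨d, rfl⟩ := Nat.exists_eq_add_of_le' hit
    rw [Function.iterate_add_apply, h.1] at hq ⊢
    exact h'.2 d (by omega) hq

theorem Reaches.of_step (h : M.step A c = c') (hq : c.l ≠ some M.query) :
    M.Reaches A b c c' 1 := by
  refine ⟨h, fun i hi hq' => ?_⟩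
  obtain rfl : i = 0 := by omega
  exact absurd hq' hq

theorem Reaches.of_query (h : M.step A c = c') (hb : (c.stk M.queryStack).length ≤ b) :
    M.Reaches A b c c' 1 := by
  refine ⟨h, fun i hi _ => ?_⟩
  obtain rfl : i = 0 := by omega
  exact hb

theorem Reaches.haltsIn (h : M.Reaches A b (M.initialCfg x) c t) (hc : c.l = none) (ht : t ≤ t') :
    M.HaltsIn A x t' :=
  HaltsIn.mono M (by rw [HaltsIn, run, h.1, hc]) ht

theorem Reaches.accepts_iff (h : M.Reaches A b (M.initialCfg x) c t) (hc : c.l = none) :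
    M.Accepts A x ↔ M.accepting c.var = true := by
  constructor
  · rintro ⟨i, hi, ha⟩
    -- Two halting times lead to the same configuration, since both persist until time `i + t`.
    have h1 : M.run A x (i + t) = c := by
      rw [run, Function.iterate_add_apply, h.1, M.iterate_step_of_halted A hc]
    have h2 : M.run A x (i + t) = M.run A x i := by
      rw [Nat.add_comm, run, Function.iterate_add_apply]
      exact M.iterate_step_of_halted A hi t
    rwa [← h1, h2]
  · intro ha
    exact ⟨t, by rw [run, h.1]; exact ⟨hc, ha⟩⟩

theorem Reaches.length_le (h : M.Reaches A b (M.initialCfg x) c t) (hc : c.l = none)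
    {w : List Bool} (hw : w ∈ M.queries A x) : w.length ≤ b := by
  obtain ⟨i, hi, rfl⟩ := hw
  rcases lt_or_ge i t with hit | hit
  · exact h.2 i hit hi
  · obtain ⟨d, rfl⟩ := Nat.exists_eq_add_of_le' hit
    rw [run, Function.iterate_add_apply, h.1, M.iterate_step_of_halted A hc, hc] at hi
    exact absurd hi (by simp)

end OracleTM

/-! ### The path problem -/

/-- The string that stands for the node `u` (read from right to left) of the `j`-th binary tree. -/
def nodeString (j : ℕ) (u : List Bool) : List Bool :=
  u ++ true :: List.replicate j false

/-- The set with parameter `W`, a word for every index. It contains, after the tag `false`, the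
nodes on the path in the `j`-th tree that is described by `W j`. After the tag `true`, a string with
`j` zeros is in the set if the path ends with `true` and the number of ones is at least
`2 ^ i`, where `i` is the number of occurrences of `true` on the path. -/
def pathSet (W : ℕ → List Bool) : Set (List Bool)
  | [] => False
  | false :: y => ∃ j u, u ≠ [] ∧ u <:+ W j ∧ y = nodeString j u
  | true :: w => (nodeString (w.count false) (W (w.count false))).head? = some true ∧
      2 ^ (W (w.count false)).count true ≤ w.count true

theorem replicate_false_append_true_inj {i i' : ℕ} {t t' : List Bool}
    (h : List.replicate i false ++ true :: t = List.replicate i' false ++ true :: t') :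
    i = i' ∧ t = t' := by
  induction i generalizing i' with
  | zero =>
    cases i' with
    | zero => simpa using h
    | succ i' => simp [List.replicate_succ] at h
  | succ i ih =>
    cases i' with
    | zero => simp [List.replicate_succ] at h
    | succ i' =>
      simp only [List.replicate_succ, List.cons_append, List.cons.injEq, true_and] at h
      simpa using ih h

theorem nodeString_inj {j j' : ℕ} {u u' : List Bool} (h : nodeString j u = nodeString j' u') :
    j = j' ∧ u = u' := by
  have := congrArg List.reverse h
  simp only [nodeString, List.reverse_append, List.reverse_cons, List.reverse_replicate,
    List.append_assoc, List.singleton_append] at this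
  simpa using replicate_false_append_true_inj this

theorem length_nodeString (j : ℕ) (u : List Bool) :
    (nodeString j u).length = u.length + j + 1 := by
  simp [nodeString]; omega

theorem false_cons_nodeString_mem {W : ℕ → List Bool} {j : ℕ} {u : List Bool} (hu : u ≠ []) :
    false :: nodeString j u ∈ pathSet W ↔ u <:+ W j := by
  constructor
  · rintro ⟨j', u', -, h, e⟩
    obtain ⟨rfl, rfl⟩ := nodeString_inj e
    exact h
  · exact fun h => ⟨j, u, hu, h, rfl⟩

/-! ### The adaptive machine that walks along the path -/

namespace PathKernel

open TM2.Stmt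

/-- The value of the internal variable that records a symbol popped from a stack. -/
def symbol : Option Bool → Fin 3
  | none => 0
  | some false => 1
  | some true => 2

/-- The program of a machine that decides `pathSet W`. A string with the tag `false` is queried.
For the tag `true`, labels `1` and `2` prepare the root of the tree on the first stack and the
ones of the input on the third. From label `3` on, the machine descends in the tree, and labels `7`
and `8` halve the number of ones whenever it goes to the child `true`. -/
def prog : Fin 9 → TM2.Stmt (fun _ : Fin 3 => Bool) (Fin 9) (Fin 3) := ![
  peek 0 (fun _ a => symbol a) <| branch (fun v => v = 1) (load (fun _ => 0) <| goto fun _ => 4) <|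
    pop 0 (fun v _ => v) <| goto fun _ => 1,
  pop 0 (fun _ a => symbol a) <| branch (fun v => v = 0) (goto fun _ => 2) <|
    branch (fun v => v = 1) (push 1 (fun _ => false) <| goto fun _ => 1) <|
    push 2 (fun _ => true) <| goto fun _ => 1,
  pop 1 (fun _ a => symbol a) <| branch (fun v => v = 0)
    (push 0 (fun _ => true) <| goto fun _ => 3) <|
    push 0 (fun _ => false) <| goto fun _ => 2,
  -- During a query the variable records its purpose: `0` for the input itself, `1` for the child
  -- `true`, `2` for the child `false`. On halting, `2` means acceptance.
  push 0 (fun _ => true) <| push 0 (fun _ => false) <| load (fun _ => 1) <| goto fun _ => 4,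
  halt,
  branch (fun v => v = 0) (load (fun _ => 2) halt) <|
    pop 0 (fun v _ => v) <| goto fun v => if v = 1 then 7 else 3,
  branch (fun v => v = 0) halt <| pop 0 (fun v _ => v) <| pop 0 (fun v _ => v) <|
    branch (fun v => v = 1)
      (push 0 (fun _ => false) <| push 0 (fun _ => false) <| load (fun _ => 2) <|
        goto fun _ => 4) <|
    pop 0 (fun _ a => symbol a) <| branch (fun v => v = 2)
      (pop 2 (fun _ a => symbol a) halt) <| load (fun _ => 0) halt,
  pop 2 (fun v _ => v) <| pop 2 (fun _ a => symbol a) <| branch (fun v => v = 0)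
    (goto fun _ => 8) <| push 1 (fun _ => true) <| goto fun _ => 7,
  pop 1 (fun _ a => symbol a) <| branch (fun v => v = 0) (goto fun _ => 3) <|
    push 2 (fun _ => true) <| goto fun _ => 8]

/-- The machine with program `prog`. -/
def machine : OracleTM where
  k := 3
  l := 9
  s := 3
  inputStack := (0 : Fin 3)
  queryStack := (0 : Fin 3)
  start := (0 : Fin 9)
  query := (4 : Fin 9)
  yes := (5 : Fin 9)
  no := (6 : Fin 9)
  startVar := (0 : Fin 3)
  accepting := fun v : Fin 3 => v = 2
  prog := prog

/-- The configuration with the given label, variable, and stacks. -/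
def cfg (l : Option (Fin 9)) (v : Fin 3) (a b d : List Bool) : machine.Cfg :=
  (⟨l, v, ![a, b, d]⟩ : TM2.Cfg (fun _ : Fin 3 => Bool) (Fin 9) (Fin 3))

theorem update_zero (a b d e : List Bool) :
    Function.update (β := fun _ : Fin 3 => List Bool) ![a, b, d] 0 e = ![e, b, d] := by
  funext k; fin_cases k <;> rfl

theorem update_one (a b d e : List Bool) :
    Function.update (β := fun _ : Fin 3 => List Bool) ![a, b, d] 1 e = ![a, e, d] := by
  funext k; fin_cases k <;> rfl

theorem update_two (a b d e : List Bool) :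
    Function.update (β := fun _ : Fin 3 => List Bool) ![a, b, d] 2 e = ![a, b, e] := by
  funext k; fin_cases k <;> rfl

variable {A : Set (List Bool)} {bd : ℕ}

theorem reaches_stepAux {l : Fin 9} (hl : l ≠ 4) (v : Fin 3) (a b d : List Bool)
    {c : machine.Cfg}
    (h : TM2.stepAux (prog l) v (![a, b, d] : Fin 3 → List Bool) = c) :
    machine.Reaches A bd (cfg (some l) v a b d) c 1 := by
  have hq : (cfg (some l) v a b d).l ≠ some machine.query :=
    fun h => hl (Option.some.inj h)
  refine .of_step ?_ hq
  rw [OracleTM.step, if_neg hq]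
  exact h

theorem reaches_yes {v : Fin 3} {a b d : List Bool} (h : a ∈ A) (hb : a.length ≤ bd) :
    machine.Reaches A bd (cfg (some 4) v a b d) (cfg (some 5) v a b d) 1 := by
  refine .of_query ?_ hb
  rw [OracleTM.step, if_pos (show (cfg (some 4) v a b d).l = some machine.query from rfl),
    if_pos (show (cfg (some 4) v a b d).stk machine.queryStack ∈ A from h)]
  rfl

theorem reaches_no {v : Fin 3} {a b d : List Bool} (h : a ∉ A) (hb : a.length ≤ bd) :
    machine.Reaches A bd (cfg (some 4) v a b d) (cfg (some 6) v a b d) 1 := by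
  refine .of_query ?_ hb
  rw [OracleTM.step, if_pos (show (cfg (some 4) v a b d).l = some machine.query from rfl),
    if_neg (show (cfg (some 4) v a b d).stk machine.queryStack ∉ A from h)]
  rfl

/-- Separating the zeros and the ones of the input. -/
theorem reaches_split (w : List Bool) : ∀ (v : Fin 3) (i n : ℕ),
    machine.Reaches A bd
      (cfg (some 1) v w (List.replicate i false) (List.replicate n true))
      (cfg (some 2) 0 [] (List.replicate (i + w.count false) false)
        (List.replicate (n + w.count true) true)) (w.length + 1) := by
  induction w with
  | nil =>
    intro v i n
    refine reaches_stepAux (by decide) _ _ _ _ ?_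
    simp [prog, cfg, symbol, update_zero]
  | cons a w ih =>
    intro v i n
    rw [List.length_cons, Nat.add_comm (w.length + 1)]
    cases a
    · refine .trans (reaches_stepAux (c := cfg (some 1) 1 w (List.replicate (i + 1) false)
        (List.replicate n true)) (by decide) _ _ _ _ ?_) ?_
      · simp [prog, cfg, symbol, update_zero, update_one, List.replicate_succ]
      · rw [List.count_cons_self, List.count_cons_of_ne (by decide), Nat.add_comm (w.count false),
          ← Nat.add_assoc]
        exact ih 1 (i + 1) n
    · refine .trans (reaches_stepAux (c := cfg (some 1) 2 w (List.replicate i false)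
        (List.replicate (n + 1) true)) (by decide) _ _ _ _ ?_) ?_
      · simp [prog, cfg, symbol, update_zero, update_two, List.replicate_succ]
      · rw [List.count_cons_self, List.count_cons_of_ne (by decide), Nat.add_comm (w.count true),
          ← Nat.add_assoc]
        exact ih 2 i (n + 1)

/-- Building the root of the tree. -/
theorem reaches_root (j : ℕ) : ∀ (v : Fin 3) (i : ℕ) (d : List Bool),
    machine.Reaches A bd
      (cfg (some 2) v (List.replicate i false) (List.replicate j false) d)
      (cfg (some 3) 0 (nodeString (i + j) []) [] d) (j + 1) := by
  induction j with
  | zero =>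
    intro v i d
    refine reaches_stepAux (by decide) _ _ _ _ ?_
    simp [prog, cfg, symbol, update_zero, update_one, nodeString]
  | succ j ih =>
    intro v i d
    rw [Nat.add_comm (j + 1)]
    refine .trans (reaches_stepAux (c := cfg (some 2) 1 (List.replicate (i + 1) false)
      (List.replicate j false) d) (by decide) _ _ _ _ ?_) ?_
    · simp [prog, cfg, symbol, update_zero, update_one, List.replicate_succ]
    · convert ih 1 (i + 1) d using 3
      omega

theorem reaches_halve (n : ℕ) : ∀ (v : Fin 3) (i : ℕ) (a : List Bool),
    machine.Reaches A bd
      (cfg (some 7) v a (List.replicate i true) (List.replicate n true))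
      (cfg (some 8) 0 a (List.replicate (i + n / 2) true) []) (n / 2 + 1) := by
  induction n using Nat.strong_induction_on with
  | _ n ih =>
    intro v i a
    match n, ih with
    | 0, _ =>
      refine reaches_stepAux (by decide) _ _ _ _ ?_
      simp [prog, cfg, symbol, update_two]
    | 1, _ =>
      refine reaches_stepAux (by decide) _ _ _ _ ?_
      simp [prog, cfg, symbol, update_two]
    | n + 2, ih =>
      rw [show (n + 2) / 2 + 1 = 1 + (n / 2 + 1) by omega]
      refine .trans (reaches_stepAux (c := cfg (some 7) 2 a (List.replicate (i + 1) true)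
        (List.replicate n true)) (by decide) _ _ _ _ ?_) ?_
      · simp [prog, cfg, symbol, update_two, update_one, List.replicate_succ]
      · rw [show i + (n + 2) / 2 = i + 1 + n / 2 by omega]
        exact ih n (by omega) 2 (i + 1) a

theorem reaches_restore (n : ℕ) : ∀ (v : Fin 3) (i : ℕ) (a : List Bool),
    machine.Reaches A bd
      (cfg (some 8) v a (List.replicate n true) (List.replicate i true))
      (cfg (some 3) 0 a [] (List.replicate (i + n) true)) (n + 1) := by
  induction n with
  | zero =>
    intro v i a
    refine reaches_stepAux (by decide) _ _ _ _ ?_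
    simp [prog, cfg, symbol, update_one]
  | succ n ih =>
    intro v i a
    rw [Nat.add_comm (n + 1)]
    refine .trans (reaches_stepAux (c := cfg (some 8) 2 a (List.replicate n true)
      (List.replicate (i + 1) true)) (by decide) _ _ _ _ ?_) ?_
    · simp [prog, cfg, symbol, update_two, update_one, List.replicate_succ]
    · convert ih 2 (i + 1) a using 3
      omega

/-- Going to the child `true`. -/
theorem reaches_true_child {v : Fin 3} {a : List Bool} {n : ℕ} (h : false :: true :: a ∈ A)
    (hb : a.length + 2 ≤ bd) :
    machine.Reaches A bd (cfg (some 3) v a [] (List.replicate n true))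
      (cfg (some 3) 0 (true :: a) [] (List.replicate (n / 2) true)) (n / 2 * 2 + 5) := by
  have h₁ : machine.Reaches A bd (cfg (some 3) v a [] (List.replicate n true))
      (cfg (some 4) 1 (false :: true :: a) [] (List.replicate n true)) 1 :=
    reaches_stepAux (by decide) _ _ _ _ (by simp [prog, cfg, update_zero])
  have h₂ : machine.Reaches A bd (cfg (some 5) 1 (false :: true :: a) [] (List.replicate n true))
      (cfg (some 7) 1 (true :: a) [] (List.replicate n true)) 1 :=
    reaches_stepAux (by decide) _ _ _ _ (by simp [prog, cfg, update_zero])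
  have h₃ := (((h₁.trans (reaches_yes h hb)).trans h₂).trans
    (reaches_halve n 1 0 _)).trans (reaches_restore _ 0 0 _)
  simp only [Nat.zero_add] at h₃
  rwa [show n / 2 * 2 + 5 = 1 + 1 + 1 + (n / 2 + 1) + (n / 2 + 1) by omega]

theorem reaches_ask_false {v : Fin 3} {a d : List Bool} (h : false :: true :: a ∉ A)
    (hb : a.length + 2 ≤ bd) :
    machine.Reaches A bd (cfg (some 3) v a [] d) (cfg (some 4) 2 (false :: false :: a) [] d) 3 := by
  have h₁ : machine.Reaches A bd (cfg (some 3) v a [] d)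
      (cfg (some 4) 1 (false :: true :: a) [] d) 1 :=
    reaches_stepAux (by decide) _ _ _ _ (by simp [prog, cfg, update_zero])
  have h₂ : machine.Reaches A bd (cfg (some 6) 1 (false :: true :: a) [] d)
      (cfg (some 4) 2 (false :: false :: a) [] d) 1 :=
    reaches_stepAux (by decide) _ _ _ _ (by simp [prog, cfg, update_zero])
  exact (h₁.trans (reaches_no h hb)).trans h₂

/-- Going to the child `false`. -/
theorem reaches_false_child {v : Fin 3} {a d : List Bool} (h : false :: true :: a ∉ A)
    (h' : false :: false :: a ∈ A) (hb : a.length + 2 ≤ bd) :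
    machine.Reaches A bd (cfg (some 3) v a [] d) (cfg (some 3) 2 (false :: a) [] d) 5 := by
  have h₁ : machine.Reaches A bd (cfg (some 5) 2 (false :: false :: a) [] d)
      (cfg (some 3) 2 (false :: a) [] d) 1 :=
    reaches_stepAux (by decide) _ _ _ _ (by simp [prog, cfg, update_zero])
  exact ((reaches_ask_false h hb).trans (reaches_yes h' hb)).trans h₁

/-- Halting at a leaf. -/
theorem reaches_leaf {v : Fin 3} {a : List Bool} {n : ℕ} (h : false :: true :: a ∉ A)
    (h' : false :: false :: a ∉ A) (hb : a.length + 2 ≤ bd) :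
    ∃ c : machine.Cfg,
      machine.Reaches A bd (cfg (some 3) v a [] (List.replicate n true)) c 5 ∧
      c.l = none ∧ (machine.accepting c.var = true ↔ a.head? = some true ∧ 1 ≤ n) := by
  have h₁ := (reaches_ask_false (v := v) (d := List.replicate n true) h hb).trans
    (reaches_no h' hb)
  refine ⟨_, h₁.trans (reaches_stepAux (by decide) _ _ _ _ rfl), ?_⟩
  rcases a with _ | ⟨_ | _, a⟩
  · simp [prog, machine, update_zero, symbol]
  · simp [prog, machine, update_zero, symbol]
  · cases n <;> simp [prog, machine, update_zero, symbol, List.replicate_succ]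

/-- The walk from a node on the path to the end of the path. -/
theorem reaches_walk {W : ℕ → List Bool} {j : ℕ} (hb : (W j).length + j + 3 ≤ bd)
    (r : List Bool) : ∀ (u : List Bool) (v : Fin 3) (n : ℕ), W j = r ++ u →
    ∃ (c : machine.Cfg) (t : ℕ), t ≤ (r.length + 1) * (n + 5) ∧
      machine.Reaches (pathSet W) bd
        (cfg (some 3) v (nodeString j u) [] (List.replicate n true)) c t ∧
      c.l = none ∧ (machine.accepting c.var = true ↔
        (nodeString j (W j)).head? = some true ∧ 2 ^ r.count true ≤ n) := by
  have hlen {r u : List Bool} (h : W j = r ++ u) : (nodeString j u).length + 2 ≤ bd := by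
    rw [length_nodeString]
    rw [h, List.length_append] at hb
    omega
  have hmem (a : Bool) (u : List Bool) :
      false :: a :: nodeString j u ∈ pathSet W ↔ a :: u <:+ W j :=
    false_cons_nodeString_mem (u := a :: u) (List.cons_ne_nil _ _)
  -- Words are read from the right, so the last symbol of `r` is the next move. A move costs at most
  -- `n + 5` steps, and the count of ones never grows.
  induction r using List.reverseRecOn with
  | nil =>
    intro u v n h
    have hleaf (a : Bool) : false :: a :: nodeString j u ∉ pathSet W := by
      rw [hmem, h]
      intro hs
      have := hs.length_le
      simp at this
    obtain ⟨c, hc, hl, ha⟩ := reaches_leaf (v := v) (n := n) (hleaf true) (hleaf false) (hlen h)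
    refine ⟨c, 5, by simp, hc, hl, ha.trans ?_⟩
    simp [h]
  | append_singleton r a ih =>
    intro u v n h
    have hW : W j = r ++ a :: u := by simpa using h
    have hmem' (b : Bool) : false :: b :: nodeString j u ∈ pathSet W ↔ b = a := by
      rw [hmem, hW]
      constructor
      -- Two suffixes of one word are comparable, so at most one child is on the path.
      · intro hs
        have := List.suffix_or_suffix_of_suffix hs (List.suffix_append r (a :: u))
        simp only [List.suffix_cons_iff, List.cons.injEq, and_true] at this
        rcases this with (h | h) | (h | h)
        · exact h
        · exact absurd h.length_le (by simp)
        · exact h.symm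
        · exact absurd h.length_le (by simp)
      · rintro rfl
        exact List.suffix_append _ _
    cases a with
    | true =>
      have h₁ := reaches_true_child (v := v) (n := n) ((hmem' true).2 rfl) (hlen h)
      obtain ⟨c, t, ht, hc, hl, ha⟩ := ih (true :: u) 0 (n / 2) hW
      refine ⟨c, _, ?_, h₁.trans hc, hl, ha.trans ?_⟩
      · calc n / 2 * 2 + 5 + t ≤ (n + 5) + (r.length + 1) * (n + 5) := by
              refine Nat.add_le_add (by omega) (ht.trans ?_)
              gcongr
              omega
          _ = _ := by simp; ring
      · rw [List.count_append, List.count_singleton_self, pow_succ,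
          Nat.le_div_iff_mul_le Nat.two_pos]
    | false =>
      have h₁ := reaches_false_child (v := v) (d := List.replicate n true)
        (by simp [hmem']) ((hmem' false).2 rfl) (hlen h)
      obtain ⟨c, t, ht, hc, hl, ha⟩ := ih (false :: u) 2 n hW
      refine ⟨c, _, ?_, h₁.trans hc, hl, ha.trans ?_⟩
      · calc 5 + t ≤ (n + 5) + (r.length + 1) * (n + 5) := by omega
          _ = _ := by simp; ring
      · rw [List.count_append]
        simp

theorem initialCfg_eq (x : List Bool) : machine.initialCfg x = cfg (some 0) 0 x [] [] := by
  refine congrArg (TM2.Cfg.mk (some (0 : Fin 9)) (0 : Fin 3)) (funext fun k : Fin 3 => ?_)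
  fin_cases k <;> rfl

/-- Runs on strings with tag `false`. -/
theorem reaches_of_false (y : List Bool) (hb : y.length + 1 ≤ bd) :
    ∃ c : machine.Cfg, machine.Reaches A bd (machine.initialCfg (false :: y)) c 3 ∧
      c.l = none ∧ (machine.accepting c.var = true ↔ false :: y ∈ A) := by
  have h₁ : machine.Reaches A bd (machine.initialCfg (false :: y))
      (cfg (some 4) 0 (false :: y) [] []) 1 := by
    rw [initialCfg_eq]
    exact reaches_stepAux (by decide) _ _ _ _ (by simp [prog, cfg, symbol])
  by_cases h : false :: y ∈ A
  · refine ⟨_, (h₁.trans (reaches_yes h hb)).trans (reaches_stepAux (by decide) _ _ _ _ rfl), ?_⟩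
    simp [prog, machine, h]
  · refine ⟨_, (h₁.trans (reaches_no h hb)).trans (reaches_stepAux (by decide) _ _ _ _ rfl), ?_⟩
    simp [prog, machine, h]

/-- Runs on the other strings. -/
theorem reaches_of_ne_false {W : ℕ → List Bool} {x : List Bool} (hx : x.head? ≠ some false)
    (hb : (W (x.tail.count false)).length + x.tail.count false + 3 ≤ bd) :
    ∃ (c : machine.Cfg) (t : ℕ),
      t ≤ 2 * x.length + 3 + ((W (x.tail.count false)).length + 1) * (x.length + 5) ∧
      machine.Reaches (pathSet W) bd (machine.initialCfg x) c t ∧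
      c.l = none ∧ (machine.accepting c.var = true ↔ x ∈ pathSet W) := by
  have h₁ : ∃ v, machine.Reaches (pathSet W) bd (machine.initialCfg x)
      (cfg (some 1) v x.tail [] []) 1 := by
    refine ⟨symbol x.head?, ?_⟩
    rw [initialCfg_eq]
    refine reaches_stepAux (by decide) _ _ _ _ ?_
    rcases x with _ | ⟨_ | _, x⟩
    · simp [prog, cfg, symbol, update_zero]
    · simp at hx
    · simp [prog, cfg, symbol, update_zero]
  obtain ⟨v, h₁⟩ := h₁
  have h₂ := reaches_split (A := pathSet W) (bd := bd) x.tail v 0 0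
  have h₃ := reaches_root (A := pathSet W) (bd := bd) (x.tail.count false) 0 0
    (List.replicate (x.tail.count true) true)
  simp only [Nat.zero_add, List.replicate_zero] at h₂ h₃
  obtain ⟨c, t, ht, hc, hl, ha⟩ := reaches_walk hb (W (x.tail.count false)) [] 0
    (x.tail.count true) (by simp)
  refine ⟨c, _, ?_, ((h₁.trans h₂).trans h₃).trans hc, hl, ha.trans ?_⟩
  · have e₁ : x.tail.length ≤ x.length := by simp
    have e₂ : x.tail.count false ≤ x.length := List.count_le_length.trans e₁
    have e₃ : x.tail.count true ≤ x.length := List.count_le_length.trans e₁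
    have := ht.trans (Nat.mul_le_mul_left ((W (x.tail.count false)).length + 1)
      (Nat.add_le_add_right e₃ 5))
    omega
  -- The empty input is run as if it had the tag `true`, and is rejected because it has no ones.
  · rcases x with _ | ⟨_ | _, x⟩
    · simp [pathSet, Membership.mem, Set.Mem]
    · simp at hx
    · exact Iff.rfl

end PathKernel

/-! ### The polynomial Turing kernelization -/

/-- The parameterized problem with the set `pathSet W`. -/
def pathProblem (W : ℕ → List Bool) : ParameterizedProblem where
  X := pathSet W
  κ := zeroExpParam
  polyTime := zeroExpParam_polyTime

open PathKernel in
theorem hasPolyTuringKernelization_pathProblem {W : ℕ → List Bool}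
    (hW : ∀ j, (W j).length ≤ (j + 2) ^ 3) :
    (pathProblem W).HasPolyTuringKernelization := by
  let q : Polynomial ℕ := (Polynomial.X + 2) ^ 3 + Polynomial.X + 3
  let p : Polynomial ℕ := 2 * Polynomial.X + 3 +
    ((Polynomial.X + 2) ^ 3 + 1) * (Polynomial.X + 5)
  have hq (n : ℕ) : q.eval n = (n + 2) ^ 3 + n + 3 := by simp [q]
  have hp (n : ℕ) : p.eval n = 2 * n + 3 + ((n + 2) ^ 3 + 1) * (n + 5) := by simp [p]
  have key (x : List Bool) : ∃ (c : machine.Cfg) (t : ℕ), t ≤ p.eval x.length ∧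
      machine.Reaches (pathSet W) (q.eval (zeroExpParam x)) (machine.initialCfg x) c t ∧
      c.l = none ∧ (machine.accepting c.var = true ↔ x ∈ pathSet W) := by
    by_cases hx : x.head? = some false
    · obtain ⟨y, rfl⟩ : ∃ y, x = false :: y := by
        rcases x with _ | ⟨_ | _, x⟩ <;> simp at hx ⊢
      -- The parameter of a string with tag `false` is so large that the string may itself be
      -- queried.
      have hb : y.length + 1 ≤ q.eval (zeroExpParam (false :: y)) := by
        have := (Nat.lt_two_pow_self (n := y.length)).le
        rw [hq, zeroExpParam]
        omega
      obtain ⟨c, hc⟩ := reaches_of_false (A := pathSet W) y hb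
      exact ⟨c, 3, by rw [hp]; omega, hc⟩
    · have hκ : x.tail.count false ≤ zeroExpParam x := by
        rcases x with _ | ⟨_ | _, x⟩
        · simp
        · simp at hx
        · exact Nat.lt_two_pow_self.le
      have hb : (W (x.tail.count false)).length + x.tail.count false + 3 ≤
          q.eval (zeroExpParam x) := by
        have := (hW (x.tail.count false)).trans
          (Nat.pow_le_pow_left (Nat.add_le_add_right hκ 2) 3)
        rw [hq]
        omega
      obtain ⟨c, t, ht, hc⟩ := reaches_of_ne_false hx hb
      refine ⟨c, t, ht.trans ?_, hc⟩
      rw [hp]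
      have e : x.tail.count false ≤ x.length :=
        List.count_le_length.trans (by simp)
      have := (hW (x.tail.count false)).trans (Nat.pow_le_pow_left (Nat.add_le_add_right e 2) 3)
      gcongr
  refine ⟨machine, q, ⟨p, fun x => ?_⟩, fun x => ?_, fun x w hw => ?_⟩ <;>
    obtain ⟨c, t, ht, hc, hl, ha⟩ := key x
  · exact hc.haltsIn hl ht
  · exact (hc.accepts_iff hl).trans ha
  · exact hc.length_le hl hw

/-! ### Power bounds and the finite-extension argument -/

theorem Polynomial.exists_eval_lt_pow (p : Polynomial ℕ) :
    ∃ c : ℕ, ∀ n : ℕ, 2 ≤ n → p.eval n < n ^ c := by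
  induction p using Polynomial.induction_on' with
  | add p q hp hq =>
    obtain ⟨c, hc⟩ := hp
    obtain ⟨d, hd⟩ := hq
    refine ⟨max c d + 1, fun n hn => ?_⟩
    have h₁ : n ^ c ≤ n ^ max c d := Nat.pow_le_pow_right (by omega) (le_max_left _ _)
    have h₂ : n ^ d ≤ n ^ max c d := Nat.pow_le_pow_right (by omega) (le_max_right _ _)
    have h₃ : n ^ max c d * 2 ≤ n ^ max c d * n := Nat.mul_le_mul_left _ hn
    rw [Polynomial.eval_add, pow_succ]
    have := hc n hn
    have := hd n hn
    omega
  | monomial k a =>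
    refine ⟨a + k, fun n hn => ?_⟩
    rw [Polynomial.eval_monomial, pow_add]
    exact Nat.mul_lt_mul_of_pos_right
      (Nat.lt_two_pow_self.trans_le (Nat.pow_le_pow_left hn a)) (by positivity)

/-- A sequence that meets countably many conditions, each of which can be forced by
changing any given admissible sequence from an arbitrary index on. -/
theorem exists_sequence_forall_mem {α : Type*} {C : ℕ → α → Prop} {S : ℕ → Set (ℕ → α)}
    (W₀ : ℕ → α) (hW₀ : ∀ j, C j (W₀ j))
    (h : ∀ (e : ℕ) (W : ℕ → α) (b : ℕ), (∀ j, C j (W j)) → ∃ (W' : ℕ → α) (b' : ℕ),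
      (∀ j, C j (W' j)) ∧ (∀ i < b, W' i = W i) ∧
        ∀ W'' : ℕ → α, (∀ i < b', W'' i = W' i) → W'' ∈ S e) :
    ∃ W : ℕ → α, (∀ j, C j (W j)) ∧ ∀ e, W ∈ S e := by
  choose f g hC heq hS using h
  -- A state is a sequence together with the length of its frozen initial segment. The maximum makes
  -- this length grow at each stage, so that entry `i` is final from stage `i + 1` on.
  let next (e : ℕ) (z : {W : ℕ → α // ∀ j, C j (W j)} × ℕ) :
      {W : ℕ → α // ∀ j, C j (W j)} × ℕ :=
    (⟨f e z.1.1 z.2 z.1.2, hC _ _ _ _⟩, max (g e z.1.1 z.2 z.1.2) (z.2 + 1))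
  let Z (n : ℕ) : {W : ℕ → α // ∀ j, C j (W j)} × ℕ :=
    Nat.rec (⟨W₀, hW₀⟩, 0) next n
  have hZ (n : ℕ) : Z (n + 1) = next n (Z n) := rfl
  have hlt (n : ℕ) : (Z n).2 + 1 ≤ (Z (n + 1)).2 := le_max_right _ _
  have hmono : Monotone fun n => (Z n).2 :=
    monotone_nat_of_le_succ fun n => (Nat.le_succ _).trans (hlt n)
  have hge (n : ℕ) : n ≤ (Z n).2 := by
    induction n with
    | zero => exact Nat.zero_le _
    | succ n ih => exact (Nat.succ_le_succ ih).trans (hlt n)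
  have hagree {n m : ℕ} (hnm : n ≤ m) : ∀ i < (Z n).2, (Z m).1.1 i = (Z n).1.1 i := by
    induction m, hnm using Nat.le_induction with
    | base => exact fun _ _ => rfl
    | succ m hnm ih =>
      intro i hi
      rw [← ih i hi]
      exact heq m _ _ _ i (hi.trans_le (hmono hnm))
  refine ⟨fun i => (Z (i + 1)).1.1 i, fun j => (Z (j + 1)).1.2 j, fun e => ?_⟩
  refine hS e (Z e).1.1 (Z e).2 (Z e).1.2 _ fun i hi => ?_
  change _ = (Z (e + 1)).1.1 i
  rcases le_total i e with hie | hie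
  · exact (hagree (Nat.succ_le_succ hie) i (hge (i + 1))).symm
  · exact hagree (Nat.succ_le_succ hie) i (hi.trans_le (le_max_left _ _))

/-! ### Counting paths with few occurrences of `true` -/

/-- Words with as many occurrences of `true` as the list has elements. -/
def blockWord (l : List ℕ) : List Bool :=
  l.flatMap fun i => List.replicate i false ++ [true]

theorem blockWord_injective : Function.Injective blockWord := by
  intro l
  induction l with
  | nil => rintro (_ | ⟨i, l⟩) h <;> simp [blockWord] at h ⊢
  | cons i l ih =>
    rintro (_ | ⟨i', l'⟩) h
    · simp [blockWord] at h
    · simp only [blockWord, List.flatMap_cons, List.append_assoc, List.singleton_append] at h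
      obtain ⟨rfl, hl⟩ := replicate_false_append_true_inj h
      rw [ih hl]

theorem count_true_blockWord (l : List ℕ) : (blockWord l).count true = l.length := by
  induction l with
  | nil => rfl
  | cons i l ih =>
    rw [blockWord, List.flatMap_cons, List.count_append, ← blockWord, ih]
    simp [List.count_replicate, Nat.add_comm]

theorem length_blockWord_le {l : List ℕ} {m : ℕ} (h : ∀ i ∈ l, i < m) :
    (blockWord l).length ≤ l.length * m := by
  induction l with
  | nil => simp [blockWord]
  | cons i l ih =>
    rw [blockWord, List.flatMap_cons, List.length_append, ← blockWord, List.length_cons,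
      Nat.succ_mul, Nat.add_comm]
    have h₁ := ih fun i hi => h i (List.mem_cons_of_mem _ hi)
    have h₂ := h i List.mem_cons_self
    simp
    omega

/-- A finite set of strings avoids a string that is assigned to one of many words. -/
theorem exists_word_notMem {s m : ℕ} {g : List Bool → List Bool} (hg : Function.Injective g)
    (F : Finset (List Bool)) (hF : F.card < m ^ s) :
    ∃ v : List Bool, v.count true = s ∧ v.length ≤ s * m ∧ g v ∉ F := by
  let w (f : Fin s → Fin m) : List Bool := blockWord (List.ofFn fun i => (f i : ℕ))
  have hw : Function.Injective w := by
    intro f f' h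
    have := List.ofFn_injective (blockWord_injective h)
    funext i
    exact Fin.ext (congrFun this i)
  classical
  obtain ⟨y, hy, hyF⟩ := Finset.exists_mem_notMem_of_card_lt_card
    (s := F) (t := Finset.univ.image fun f => g (w f)) (by
      rw [Finset.card_image_of_injective _
        (show Function.Injective fun f => g (w f) from hg.comp hw)]
      simpa using hF)
  obtain ⟨f, -, rfl⟩ := Finset.mem_image.1 hy
  refine ⟨w f, ?_, ?_, hyF⟩
  · rw [count_true_blockWord, List.length_ofFn]
  · refine (length_blockWord_le (m := m) ?_).trans (by rw [List.length_ofFn])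
    intro i hi
    obtain ⟨k, rfl⟩ := (List.mem_ofFn' _ _).1 hi
    exact (f k).2

/-! ### Defeating one nonadaptive machine -/

/-- The index of the tree is spelled out in zeros, so a short string consults only words with small
index. This is why a defeat depends on finitely many values of `W`. -/
theorem mem_pathSet_congr {W W' : ℕ → List Bool} {m : ℕ} (h : ∀ i < m, W i = W' i)
    {x : List Bool} (hx : x.length ≤ m) : x ∈ pathSet W ↔ x ∈ pathSet W' := by
  rcases x with _ | ⟨_ | _, y⟩
  · exact Iff.rfl
  · refine exists_congr fun j => exists_congr fun u => and_congr_right fun _ =>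
      and_congr_left fun e => ?_
    rw [e, List.length_cons, length_nodeString] at hx
    rw [h j (by omega)]
  · have : y.count false ≤ y.length := List.count_le_length
    rw [List.length_cons] at hx
    change _ ∧ _ ↔ _ ∧ _
    rw [h _ (by omega)]

/-- Extending the `j`-th path by `true` changes only one of the short strings. -/
theorem mem_pathSet_update {W : ℕ → List Bool} {j : ℕ} {u x : List Bool}
    (hu : x.length < 2 ^ u.count true) (hx : x ≠ false :: nodeString j (true :: u)) :
    x ∈ pathSet (Function.update W j u) ↔ x ∈ pathSet (Function.update W j (true :: u)) := by
  rcases x with _ | ⟨_ | _, y⟩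
  · exact Iff.rfl
  · refine exists_congr fun j' => exists_congr fun u' => and_congr_right fun _ =>
      and_congr_left fun e => ?_
    rcases eq_or_ne j' j with rfl | hj
    · rw [Function.update_self, Function.update_self, List.suffix_cons_iff]
      refine (or_iff_right ?_).symm
      rintro rfl
      exact hx (by rw [e])
    · rw [Function.update_of_ne hj, Function.update_of_ne hj]
  · change _ ∧ _ ↔ _ ∧ _
    rcases eq_or_ne (y.count false) j with hj | hj
    · have : y.count true ≤ y.length := List.count_le_length
      rw [List.length_cons] at hu
      rw [hj, Function.update_self, Function.update_self, List.count_cons_self, pow_succ]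
      -- Both sides are false: the string has too few ones for either threshold.
      constructor <;> rintro ⟨-, h⟩ <;> omega
    · rw [Function.update_of_ne hj, Function.update_of_ne hj]

/-- The first estimate keeps queries below the threshold `2 ^ (j ^ 2)`; the second bounds the number
of queries by the number of candidate paths. For the latter, the left side is at most `(8 ^ c) ^ (j
^ 2)`, so `j ≥ 8 ^ c` suffices. -/
theorem exists_large_index (c d b : ℕ) : ∃ j, b ≤ j ∧ 1 ≤ j ∧ (2 ^ j) ^ d ≤ 2 ^ (j ^ 2) ∧
    (1 + j + 2 ^ (j ^ 2 + 1)) ^ c ≤ j ^ (j ^ 2) := by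
  have h1 : 1 ≤ 8 ^ c := Nat.one_le_pow _ _ (by omega)
  refine ⟨b + d + 8 ^ c, by omega, by omega, ?_, ?_⟩
  · rw [← pow_mul, sq]
    refine Nat.pow_le_pow_right Nat.two_pos (Nat.mul_le_mul_left _ ?_)
    exact (Nat.le_add_left d b).trans (Nat.le_add_right _ _)
  · have h8 : 8 ^ c ≤ b + d + 8 ^ c := Nat.le_add_left _ _
    generalize b + d + 8 ^ c = j at *
    have hj : j ≤ j ^ 2 := Nat.le_self_pow two_ne_zero j
    have h2 : j ^ 2 < 2 ^ j ^ 2 := Nat.lt_two_pow_self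
    calc (1 + j + 2 ^ (j ^ 2 + 1)) ^ c ≤ (2 ^ (j ^ 2 + 2)) ^ c := by
          refine Nat.pow_le_pow_left ?_ c
          rw [pow_succ, pow_add]
          omega
      _ ≤ (2 ^ (3 * j ^ 2)) ^ c :=
          Nat.pow_le_pow_left (Nat.pow_le_pow_right Nat.two_pos (by omega)) c
      _ = (8 ^ c) ^ j ^ 2 := by
          rw [show 8 = 2 ^ 3 from rfl, ← pow_mul, ← pow_mul, ← pow_mul]
          congr 1
          ring
      _ ≤ j ^ j ^ 2 := Nat.pow_le_pow_left h8 _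

/-- The input on which a machine is defeated at the index `j`. -/
def hardInput (j n : ℕ) : List Bool :=
  true :: (List.replicate j false ++ List.replicate n true)

theorem count_false_hardInput_tail (j n : ℕ) :
    (List.replicate j false ++ List.replicate n true).count false = j := by
  simp [List.count_replicate]

theorem count_true_hardInput_tail (j n : ℕ) :
    (List.replicate j false ++ List.replicate n true).count true = n := by
  simp [List.count_replicate]

theorem zeroExpParam_hardInput (j n : ℕ) : zeroExpParam (hardInput j n) = 2 ^ j := by
  rw [hardInput, zeroExpParam, count_false_hardInput_tail]

theorem length_hardInput (j n : ℕ) : (hardInput j n).length = 1 + j + n := by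
  simp [hardInput]; omega

theorem hardInput_mem {W : ℕ → List Bool} {j n : ℕ} : hardInput j n ∈ pathSet W ↔
    (nodeString j (W j)).head? = some true ∧ 2 ^ (W j).count true ≤ n := by
  change _ ∧ _ ↔ _
  rw [count_false_hardInput_tail, count_true_hardInput_tail]

/-- The machine `M` does not solve `pathProblem W` nonadaptively with time bound `n ^ c` and query
length bound `k ^ d`. -/
def Defeats (W : ℕ → List Bool) (M : OracleTM) (c d : ℕ) : Prop :=
  ¬ (M.Nonadaptive ∧ (∀ x : List Bool, 2 ≤ x.length → M.HaltsIn (pathSet W) x (x.length ^ c)) ∧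
    (∀ x, M.Accepts (pathSet W) x ↔ x ∈ pathSet W) ∧
    ∀ x, 2 ≤ zeroExpParam x → ∀ w ∈ M.queries (pathSet W) x, w.length < zeroExpParam x ^ d)

theorem exists_forall_defeats (M : OracleTM) (c d : ℕ) (W : ℕ → List Bool) (b : ℕ)
    (hW : ∀ j, (W j).length ≤ (j + 2) ^ 3) :
    ∃ (W' : ℕ → List Bool) (b' : ℕ), (∀ j, (W' j).length ≤ (j + 2) ^ 3) ∧
      (∀ i < b, W' i = W i) ∧
      ∀ W'' : ℕ → List Bool, (∀ i < b', W'' i = W' i) → Defeats W'' M c d := by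
  obtain ⟨j, hbj, hj, hd, hc⟩ := exists_large_index (c + 1) d b
  set s := j ^ 2 with hs
  -- The number of ones is exactly the threshold of a path with `s + 1` symbols `true`.
  set x := hardInput j (2 ^ (s + 1)) with hx
  have hx2 : 2 ≤ x.length := by rw [hx, length_hardInput]; omega
  have hκ : zeroExpParam x = 2 ^ j := zeroExpParam_hardInput _ _
  have hκ2 : 2 ≤ zeroExpParam x := hκ ▸ Nat.le_self_pow (by omega) 2
  -- The queries of a nonadaptive machine can be inspected with the oracle `∅`, before the path is
  -- chosen.
  by_cases hM : M.Nonadaptive ∧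
      (∃ F : Finset (List Bool), F.card ≤ x.length ^ c ∧ M.queries ∅ x ⊆ F) ∧
      ∀ w ∈ M.queries ∅ x, w.length < (2 ^ j) ^ d
  · obtain ⟨hna, ⟨F, hF, hQF⟩, hQ⟩ := hM
    have hF' : F.card < j ^ s := by
      refine hF.trans_lt (lt_of_lt_of_le ?_ hc)
      rw [← length_hardInput]
      exact Nat.pow_lt_pow_right hx2 (Nat.lt_succ_self c)
    -- The path will be `false :: v` or `true :: false :: v`. The `false` makes the first option a
    -- negative instance; the node ending the second is not queried.
    obtain ⟨v, hvs, hvl, hvF⟩ := exists_word_notMem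
      (g := fun v => false :: nodeString j (true :: false :: v))
      (fun v v' h => by simpa using (nodeString_inj (List.cons.inj h).2).2) F hF'
    set u := false :: v with hu
    have hus : u.count true = s := by rw [hu, List.count_cons_of_ne (by decide), hvs]
    have hul : (true :: u).length ≤ (j + 2) ^ 3 := by
      rw [hu, List.length_cons, List.length_cons]
      calc v.length + 1 + 1 ≤ s * j + 1 + 1 := by omega
        _ ≤ (j + 2) ^ 3 := by rw [hs]; nlinarith
    have hagree : ∀ w ∈ M.queries ∅ x, w ∈ pathSet (Function.update W j u) ↔
        w ∈ pathSet (Function.update W j (true :: u)) := by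
      intro w hw
      refine mem_pathSet_update ?_ ?_
      · rw [hus]
        exact (hQ w hw).trans_le hd
      · rintro rfl
        exact hvF (hQF hw)
    have h₀ : x ∉ pathSet (Function.update W j u) := by
      rw [hx, hardInput_mem, Function.update_self]
      simp [nodeString, hu]
    have h₁ : x ∈ pathSet (Function.update W j (true :: u)) := by
      rw [hx, hardInput_mem, Function.update_self, List.count_cons_self, hus]
      exact ⟨rfl, le_rfl⟩
    obtain ⟨u', hu', hacc⟩ : ∃ u' : List Bool, u'.length ≤ (j + 2) ^ 3 ∧
        ¬ (M.Accepts (pathSet (Function.update W j u')) x ↔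
          x ∈ pathSet (Function.update W j u')) := by
      -- The machine gives the same answer for both paths, so it errs on one of them.
      by_cases h : M.Accepts (pathSet (Function.update W j u)) x
      · exact ⟨u, (Nat.le_succ _).trans hul, fun h' => h₀ (h'.1 h)⟩
      · refine ⟨true :: u, hul, fun h' => h ?_⟩
        rw [M.accepts_congr (B := pathSet (Function.update W j (true :: u)))]
        · exact h'.2 h₁
        · rwa [hna x _ ∅]
    -- Freezing `W` up to this index fixes the membership of `x` and of every queried string.
    refine ⟨Function.update W j u', x.length + (2 ^ j) ^ d, fun i => ?_, fun i hi => ?_,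
      fun W'' hW'' => ?_⟩
    · rcases eq_or_ne i j with rfl | hij
      · rwa [Function.update_self]
      · rw [Function.update_of_ne hij]
        exact hW i
    · exact Function.update_of_ne (by omega) _ _
    · rintro ⟨-, -, hdec, -⟩
      refine hacc ?_
      rw [← mem_pathSet_congr hW'' (Nat.le_add_right _ _), ← hdec x]
      refine M.accepts_congr fun w hw => (mem_pathSet_congr hW'' ?_).symm
      rw [hna x _ ∅] at hw
      exact (hQ w hw).le.trans (Nat.le_add_left _ _)
  -- Here the machine is adaptive, or on `x` it makes too many or too long queries; with
  -- nonadaptivity this violates its bounds for every `W''`.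
  · refine ⟨W, 0, hW, fun _ _ => rfl, fun W'' _ => ?_⟩
    rintro ⟨hna, hhalt, -, hsize⟩
    refine hM ⟨hna, ?_, ?_⟩
    · rw [hna x ∅ (pathSet W'')]
      exact M.exists_finset_queries (hhalt x hx2)
    · rw [hna x ∅ (pathSet W''), ← hκ]
      exact hsize x hκ2

theorem theorem4 :
    ∃ P : ParameterizedProblem,
      P.HasPolyTuringKernelization ∧ ¬ P.HasPolyTruthTableKernelization := by
  have : Nonempty OracleTM := ⟨PathKernel.machine⟩
  obtain ⟨e, he⟩ := exists_surjective_nat (OracleTM × ℕ × ℕ)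
  obtain ⟨W, hW, hdef⟩ := exists_sequence_forall_mem
    (C := fun j (w : List Bool) => w.length ≤ (j + 2) ^ 3)
    (S := fun n => {W | Defeats W (e n).1 (e n).2.1 (e n).2.2})
    (fun _ => []) (by simp) fun n W b hW => exists_forall_defeats _ _ _ W b hW
  refine ⟨pathProblem W, hasPolyTuringKernelization_pathProblem hW, ?_⟩
  rintro ⟨M, q, hM, hna⟩
  obtain ⟨p, hp⟩ := hM.polyTime
  obtain ⟨c, hc⟩ := p.exists_eval_lt_pow
  obtain ⟨d, hd⟩ := q.exists_eval_lt_pow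
  obtain ⟨n, hn⟩ := he (M, c, d)
  have hn' : Defeats W (e n).1 (e n).2.1 (e n).2.2 := hdef n
  rw [hn] at hn'
  refine hn' ⟨hna, fun x hx => ?_, hM.decides, fun x hx w hw => ?_⟩
  · exact (hp x).mono M (hc _ hx).le
  · exact (hM.size x w hw).trans_lt (hd _ hx)
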